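/- Let $E\neq 0$ be a uniformly convex Banach space over $\mathbb K=\mathbb R$ or $\mathbb C$ and let $\rho$ be a unitary representation of the free group $F_2$ of rank two on $E$, that is, a homomorphism from $F_2$ to the group of norm-preserving $\mathbb K$-linear automorphisms of $E$. A function $F:F_2\to E$ is a cocycle if $F(gg')=F(g)+\rho(g)F(g')$ for all $g,g'\in F_2$, and a quasi-cocycle if $\sup_{g,g'\in F_2}\|F(gg')-F(g)-\rho(g)F(g')\|<\infty$. Let $QC(F_2;\rho)$ be the vector space of quasi-cocycles, and let $\widetilde{QC}(F_2;\rho)$ be its quotient by the subspace generated by the bounded functions $F_2\to E$ and the cocycles. Then $$\dim_{\mathbb K}\widetilde{QC}(F_2;\rho)=\infty .$$ Equivalently, the kernel of the comparison map $H^2_b(F_2;\rho)\to H^2(F_2;\rho)$ from the second bounded cohomology to the second group cohomology of $F_2$ with coefficients in $\rho$ is infinite dimensional over $\mathbb K$. -/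

import Mathlib

namespace QuasiCocycle

section Defs

variable {𝕜 : Type*} [RCLike 𝕜] {G : Type*} [Group G]
  {E : Type*} [NormedAddCommGroup E] [NormedSpace 𝕜 E]

variable (𝕜) in
/-- The space of norm-bounded functions `X → E`. -/
def boundedFunctions (X E : Type*) [NormedAddCommGroup E] [NormedSpace 𝕜 E] :
    Submodule 𝕜 (X → E) where
  carrier := {F | ∃ C : ℝ, ∀ x, ‖F x‖ ≤ C}
  zero_mem' := ⟨0, fun x => by simp⟩
  add_mem' := by
    rintro F F' ⟨C, hC⟩ ⟨C', hC'⟩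
    exact ⟨C + C', fun x => norm_add_le_of_le (hC x) (hC' x)⟩
  smul_mem' := by
    rintro c F ⟨C, hC⟩
    refine ⟨‖c‖ * C, fun x => ?_⟩
    rw [Pi.smul_apply, norm_smul]
    exact mul_le_mul_of_nonneg_left (hC x) (norm_nonneg c)

/-- Cocycles for `ρ`: functions with `F (g g') = F g + ρ g (F g')`. -/
def cocycles (ρ : G →* (E ≃ₗᵢ[𝕜] E)) : Submodule 𝕜 (G → E) where
  carrier := {F | ∀ g g', F (g * g') = F g + ρ g (F g')}
  zero_mem' := fun g g' => by simp
  add_mem' := by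
    intro F F' h h' g g'
    simp only [Pi.add_apply, h g g', h' g g', map_add]
    abel
  smul_mem' := by
    intro c F h g g'
    simp only [Pi.smul_apply, h g g', map_smul, smul_add]

/-- Quasi-cocycles for `ρ`: functions whose defect
`sup ‖F (g g') - F g - ρ g (F g')‖` is finite. -/
def quasiCocycles (ρ : G →* (E ≃ₗᵢ[𝕜] E)) : Submodule 𝕜 (G → E) where
  carrier := {F | ∃ C : ℝ, ∀ g g', ‖F (g * g') - F g - ρ g (F g')‖ ≤ C}
  zero_mem' := ⟨0, fun g g' => by simp⟩
  add_mem' := by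
    rintro F F' ⟨C, hC⟩ ⟨C', hC'⟩
    refine ⟨C + C', fun g g' => ?_⟩
    have h : (F + F') (g * g') - (F + F') g - ρ g ((F + F') g') =
        (F (g * g') - F g - ρ g (F g')) + (F' (g * g') - F' g - ρ g (F' g')) := by
      simp only [Pi.add_apply, map_add]
      abel
    rw [h]
    exact norm_add_le_of_le (hC g g') (hC' g g')
  smul_mem' := by
    rintro c F ⟨C, hC⟩
    refine ⟨‖c‖ * C, fun g g' => ?_⟩
    have h : (c • F) (g * g') - (c • F) g - ρ g ((c • F) g') =
        c • (F (g * g') - F g - ρ g (F g')) := by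
      simp only [Pi.smul_apply, map_smul, smul_sub]
    rw [h, norm_smul]
    exact mul_le_mul_of_nonneg_left (hC g g') (norm_nonneg c)

theorem boundedFunctions_sup_cocycles_le (ρ : G →* (E ≃ₗᵢ[𝕜] E)) :
    boundedFunctions 𝕜 G E ⊔ cocycles ρ ≤ quasiCocycles ρ := by
  refine sup_le ?_ ?_
  · rintro F ⟨C, hC⟩
    refine ⟨C + C + C, fun g g' => ?_⟩
    refine (norm_sub_le_of_le (norm_sub_le_of_le (hC _) (hC _)) ?_)
    rw [LinearIsometryEquiv.norm_map]
    exact hC g'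
  · intro F hF
    exact ⟨0, fun g g' => by rw [hF g g']; simp⟩

/-- The space of essential quasi-cocycles: quasi-cocycles modulo the subspace generated by the
bounded functions and the cocycles. -/
abbrev EssentialQuasiCocycles (ρ : G →* (E ≃ₗᵢ[𝕜] E)) : Type _ :=
  quasiCocycles ρ ⧸ (boundedFunctions 𝕜 G E ⊔ cocycles ρ).submoduleOf (quasiCocycles ρ)

/-- The coboundary from 1-cochains to 2-cochains in the inhomogeneous complex with coefficients
in `ρ`. -/
def coboundary₁ (ρ : G →* (E ≃ₗᵢ[𝕜] E)) : (G → E) →ₗ[𝕜] (G × G → E) where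
  toFun F := fun p => ρ p.1 (F p.2) - F (p.1 * p.2) + F p.1
  map_add' F F' := by
    funext p
    simp only [Pi.add_apply, map_add]
    abel
  map_smul' c F := by
    funext p
    simp only [Pi.smul_apply, map_smul, smul_sub, smul_add, RingHom.id_apply]

/-- The coboundary from 2-cochains to 3-cochains in the inhomogeneous complex with coefficients
in `ρ`. -/
def coboundary₂ (ρ : G →* (E ≃ₗᵢ[𝕜] E)) : (G × G → E) →ₗ[𝕜] (G × G × G → E) where
  toFun c := fun p =>
    ρ p.1 (c (p.2.1, p.2.2)) - c (p.1 * p.2.1, p.2.2) + c (p.1, p.2.1 * p.2.2) - c (p.1, p.2.1)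
  map_add' c c' := by
    funext p
    simp only [Pi.add_apply, map_add]
    abel
  map_smul' r c := by
    funext p
    simp only [Pi.smul_apply, map_smul, smul_sub, smul_add, RingHom.id_apply]

theorem coboundary₂_coboundary₁ (ρ : G →* (E ≃ₗᵢ[𝕜] E)) (F : G → E) :
    coboundary₂ ρ (coboundary₁ ρ F) = 0 := by
  funext p
  simp only [coboundary₁, coboundary₂, LinearMap.coe_mk, AddHom.coe_mk, map_mul, map_sub, map_add,
    LinearIsometryEquiv.coe_mul, Function.comp_apply, mul_assoc, Pi.zero_apply]
  abel

theorem coboundary₁_bounded (ρ : G →* (E ≃ₗᵢ[𝕜] E)) {F : G → E}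
    (hF : F ∈ boundedFunctions 𝕜 G E) :
    coboundary₁ ρ F ∈ boundedFunctions 𝕜 (G × G) E := by
  obtain ⟨C, hC⟩ := hF
  refine ⟨C + C + C, fun p => norm_add_le_of_le (norm_sub_le_of_le ?_ (hC _)) (hC _)⟩
  rw [LinearIsometryEquiv.norm_map]
  exact hC p.2

/-- The 2-cocycles. -/
def Z2 (ρ : G →* (E ≃ₗᵢ[𝕜] E)) : Submodule 𝕜 (G × G → E) := LinearMap.ker (coboundary₂ ρ)

/-- The 2-coboundaries. -/
def B2 (ρ : G →* (E ≃ₗᵢ[𝕜] E)) : Submodule 𝕜 (G × G → E) := LinearMap.range (coboundary₁ ρ)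

/-- The bounded 2-cocycles. -/
def Z2b (ρ : G →* (E ≃ₗᵢ[𝕜] E)) : Submodule 𝕜 (G × G → E) :=
  Z2 ρ ⊓ boundedFunctions 𝕜 (G × G) E

/-- The coboundaries of bounded 1-cochains. -/
def B2b (ρ : G →* (E ≃ₗᵢ[𝕜] E)) : Submodule 𝕜 (G × G → E) :=
  (boundedFunctions 𝕜 G E).map (coboundary₁ ρ)

theorem B2_le_Z2 (ρ : G →* (E ≃ₗᵢ[𝕜] E)) : B2 ρ ≤ Z2 ρ := by
  rintro _ ⟨F, rfl⟩
  exact coboundary₂_coboundary₁ ρ F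

theorem B2b_le_Z2b (ρ : G →* (E ≃ₗᵢ[𝕜] E)) : B2b ρ ≤ Z2b ρ := by
  rintro _ ⟨F, hF, rfl⟩
  exact ⟨coboundary₂_coboundary₁ ρ F, coboundary₁_bounded ρ hF⟩

/-- The second group cohomology with coefficients in `ρ`. -/
abbrev H2 (ρ : G →* (E ≃ₗᵢ[𝕜] E)) : Type _ := Z2 ρ ⧸ (B2 ρ).submoduleOf (Z2 ρ)

/-- The second bounded cohomology with coefficients in `ρ`. -/
abbrev H2b (ρ : G →* (E ≃ₗᵢ[𝕜] E)) : Type _ := Z2b ρ ⧸ (B2b ρ).submoduleOf (Z2b ρ)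

/-- The comparison map from bounded cohomology to cohomology in degree two, induced by the
inclusion of the bounded 2-cocycles in the 2-cocycles. -/
def comparison (ρ : G →* (E ≃ₗᵢ[𝕜] E)) : H2b ρ →ₗ[𝕜] H2 ρ :=
  Submodule.mapQ _ _ (Submodule.inclusion (inf_le_left : Z2b ρ ≤ Z2 ρ)) (by
    rintro x ⟨F, _, hF⟩
    exact ⟨F, hF⟩)

end Defs

end QuasiCocycle

/-!
Let `f` be a finitely supported alternating function on a factor of a free product. Rolli's
quasi-cocycle `F` sums the values of `f` along the normal form of an element, twisted by `ρ`. When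
two normal forms are multiplied, inverse syllables cancel and their contributions to `F` do as
well, so only the single pair of syllables that may merge contributes to the defect of `F`.

Let `b ≠ 1` lie in another factor, and suppose that `F` differs from a cocycle by a bounded
function. The products `a * b` act by affine isometries on a bounded set, and uniform convexity
yields almost fixed points of that action: this perturbs the cocycle to be uniformly close to `F`
at every `a * b`, where `F (a * b) = f a`. So away from `1`, `f` is uniformly close to functions of
the form `a ↦ C a + ρ a v` with `C` a cocycle. As `f` vanishes off a finite subset of an infinite
group, this forces `f = 0`. Hence `f ↦ F` is injective modulo bounded functions and cocycles.
-/

open Filter Metric Monoid.CoprodI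

section EnclosingBalls

theorem exists_subset_closedBall_forall_lt_add {X : Type*} [PseudoMetricSpace X] {O : Set X}
    (hO : O.Nonempty) (hb : Bornology.IsBounded O) {η : ℝ} (hη : 0 < η) :
    ∃ c r, O ⊆ closedBall c r ∧ ∀ x s, O ⊆ closedBall x s → r < s + η := by
  obtain ⟨o, ho⟩ := hO
  obtain ⟨R, hR⟩ := hb.subset_closedBall o
  have hne : {r | ∃ x, O ⊆ closedBall x r}.Nonempty := ⟨R, o, hR⟩
  have hbdd : BddBelow {r | ∃ x, O ⊆ closedBall x r} :=
    ⟨0, fun _ ⟨_, hx⟩ => dist_nonneg.trans (hx ho)⟩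
  obtain ⟨r, ⟨c, hc⟩, hr⟩ := exists_lt_of_csInf_lt hne (lt_add_of_pos_right _ hη)
  exact ⟨c, r, hc, fun x s hx => hr.trans_le (by gcongr; exact csInf_le hbdd ⟨x, hx⟩)⟩

variable {E : Type*} [SeminormedAddCommGroup E] [NormedSpace ℝ E] [UniformConvexSpace E]

variable (E) in
theorem exists_forall_norm_add_le_mul_two_sub {R ε : ℝ} (hR : 0 < R) (hε : 0 < ε) :
    ∃ δ, 0 < δ ∧ ∀ r ≤ R, ∀ ⦃x : E⦄, ‖x‖ ≤ r → ∀ ⦃y⦄, ‖y‖ ≤ r → ε ≤ ‖x - y‖ →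
      ‖x + y‖ ≤ r * (2 - δ) := by
  obtain ⟨δ, hδ, h⟩ := exists_forall_closed_ball_dist_add_le_two_sub E (div_pos hε hR)
  refine ⟨δ, hδ, fun r hrR x hx y hy hxy => ?_⟩
  have hr : 0 < r := by linarith [norm_sub_le x y]
  have hnorm (z : E) : ‖r⁻¹ • z‖ = ‖z‖ / r := by
    rw [norm_smul_of_nonneg (inv_nonneg.2 hr.le), inv_mul_eq_div]
  have hunit := @h (r⁻¹ • x) (by rwa [hnorm, div_le_one hr])
    (r⁻¹ • y) (by rwa [hnorm, div_le_one hr])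
    (by rw [← smul_sub, hnorm]; gcongr)
  rwa [← smul_add, hnorm, div_le_iff₀' hr] at hunit

/-- The centre `c` of an almost minimal enclosing ball of `O` works: `T⁻¹ c` is the centre of
another one, and by uniform convexity the midpoint of two distant such centres would be the centre
of a much smaller one. -/
theorem exists_forall_isometryEquiv_dist_lt {O : Set E} (hO : O.Nonempty)
    (hb : Bornology.IsBounded O) {ε : ℝ} (hε : 0 < ε) :
    ∃ c : E, ∀ T : E ≃ᵢ E, Set.MapsTo T O O → dist (T c) c < ε := by
  obtain ⟨R, hR0, hR⟩ := hb.subset_closedBall_lt 0 0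
  obtain ⟨δ, hδ, hconvex⟩ := exists_forall_norm_add_le_mul_two_sub E (add_pos hR0 one_pos) hε
  obtain ⟨c, r, hc, hmin⟩ := exists_subset_closedBall_forall_lt_add hO hb
    (lt_min one_pos (by positivity : 0 < ε * δ / 4))
  refine ⟨c, fun T hT => ?_⟩
  by_contra! hε_le
  have hsymm : O ⊆ closedBall (T.symm c) r := fun o ho => by
    rw [mem_closedBall, ← T.dist_eq, T.apply_symm_apply]
    exact hc (hT ho)
  have hdist : ε ≤ dist c (T.symm c) := by rwa [← T.dist_eq, T.apply_symm_apply]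
  have hrR : r ≤ R + 1 := (hmin 0 R hR).le.trans (by gcongr; exact min_le_left _ _)
  have hmid : O ⊆ closedBall (midpoint ℝ c (T.symm c)) (r * (2 - δ) / 2) := fun o ho => by
    have hadd := hconvex r hrR (x := c - o) (by rw [← dist_eq_norm']; exact hc ho)
      (y := T.symm c - o) (by rw [← dist_eq_norm']; exact hsymm ho)
      (by rwa [sub_sub_sub_cancel_right, ← dist_eq_norm])
    have hsub : midpoint ℝ c (T.symm c) - o = (2⁻¹ : ℝ) • (c - o + (T.symm c - o)) := by
      rw [midpoint_eq_smul_add, invOf_eq_inv]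
      module
    rw [mem_closedBall, dist_eq_norm', hsub, norm_smul_of_nonneg (by norm_num)]
    linarith
  have hsmall : r * δ < ε * δ / 2 := by
    linarith [hmin _ _ hmid, min_le_right 1 (ε * δ / 4)]
  have hlarge : ε ≤ 2 * r := by
    obtain ⟨o, ho⟩ := hO
    linarith [dist_triangle_right c (T.symm c) o, mem_closedBall'.1 (hc ho),
      mem_closedBall'.1 (hsymm ho)]
  nlinarith

end EnclosingBalls

namespace QuasiCocycle

section Coboundary

variable {𝕜 : Type*} [RCLike 𝕜] {G : Type*} [Group G]
  {E : Type*} [NormedAddCommGroup E] [NormedSpace 𝕜 E] (ρ : G →* (E ≃ₗᵢ[𝕜] E)) (F : G → E)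

theorem coboundary₁_apply (g h : G) :
    coboundary₁ ρ F (g, h) = ρ g (F h) - F (g * h) + F g := rfl

theorem coboundary₁_eq_zero_iff {g h : G} :
    coboundary₁ ρ F (g, h) = 0 ↔ F (g * h) = F g + ρ g (F h) := by
  rw [coboundary₁_apply, sub_add_eq_add_sub, sub_eq_zero, eq_comm, add_comm]

theorem coboundary₁_mul_left (g h k : G) :
    coboundary₁ ρ F (g * h, k) =
      ρ g (coboundary₁ ρ F (h, k)) + coboundary₁ ρ F (g, h * k) - coboundary₁ ρ F (g, h) := by
  have hzero : ρ g (coboundary₁ ρ F (h, k)) - coboundary₁ ρ F (g * h, k) +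
      coboundary₁ ρ F (g, h * k) - coboundary₁ ρ F (g, h) = 0 :=
    congrFun (coboundary₂_coboundary₁ ρ F) (g, h, k)
  rw [← sub_eq_zero, ← neg_eq_zero, ← hzero]
  abel

theorem ker_coboundary₁ : LinearMap.ker (coboundary₁ ρ) = cocycles ρ := by
  ext F
  rw [LinearMap.mem_ker, funext_iff, Prod.forall]
  exact forall₂_congr fun _ _ => coboundary₁_eq_zero_iff ρ F

theorem comap_coboundary₁_boundedFunctions :
    (boundedFunctions 𝕜 (G × G) E).comap (coboundary₁ ρ) = quasiCocycles ρ := by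
  ext F
  refine exists_congr fun C => Prod.forall.trans (forall₂_congr fun g h => ?_)
  rw [coboundary₁_apply, ← norm_neg, neg_add', neg_sub, sub_right_comm]

theorem sub_apply_mem_cocycles (v : E) : (fun g => v - ρ g v) ∈ cocycles ρ := fun g h => by
  simp only [map_sub, map_mul, LinearIsometryEquiv.coe_mul, Function.comp_apply]
  abel

variable {ρ F} {H : Type*} [Group H]

theorem comp_mem_quasiCocycles (hF : F ∈ quasiCocycles ρ) (φ : H →* G) :
    F ∘ φ ∈ quasiCocycles (ρ.comp φ) := by
  obtain ⟨C, hC⟩ := hF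
  exact ⟨C, fun g h => by simpa using hC (φ g) (φ h)⟩

theorem comp_mem_boundedFunctions_sup_cocycles (hF : F ∈ boundedFunctions 𝕜 G E ⊔ cocycles ρ)
    (φ : H →* G) : F ∘ φ ∈ boundedFunctions 𝕜 H E ⊔ cocycles (ρ.comp φ) := by
  obtain ⟨B, ⟨K, hK⟩, C, hC, rfl⟩ := Submodule.mem_sup.1 hF
  exact Submodule.mem_sup.2 ⟨B ∘ φ, ⟨K, fun _ => hK _⟩, C ∘ φ,
    fun g h => by simpa using hC (φ g) (φ h), rfl⟩

end Coboundary

section Comparison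

variable {𝕜 : Type*} [RCLike 𝕜] {G : Type*} [Group G]
  {E : Type*} [NormedAddCommGroup E] [NormedSpace 𝕜 E] (ρ : G →* (E ≃ₗᵢ[𝕜] E))

theorem coboundary₁_mem_Z2b {F : G → E} (hF : F ∈ quasiCocycles ρ) : coboundary₁ ρ F ∈ Z2b ρ :=
  ⟨coboundary₂_coboundary₁ ρ F, (comap_coboundary₁_boundedFunctions ρ).ge hF⟩

/-- The connecting map from quasi-cocycles to the kernel of the comparison map, sending a
quasi-cocycle to the class of its coboundary. -/
def quasiCocyclesToKerComparison : quasiCocycles ρ →ₗ[𝕜] LinearMap.ker (comparison ρ) :=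
  (Submodule.mkQ _ ∘ₗ (coboundary₁ ρ).restrict fun _ => coboundary₁_mem_Z2b ρ).codRestrict _
    fun F => (Submodule.Quotient.mk_eq_zero _).2 ⟨F, rfl⟩

theorem ker_quasiCocyclesToKerComparison : LinearMap.ker (quasiCocyclesToKerComparison ρ) =
    (boundedFunctions 𝕜 G E ⊔ cocycles ρ).submoduleOf (quasiCocycles ρ) := by
  ext F
  rw [← ker_coboundary₁, ← Submodule.comap_map_eq]
  exact Subtype.ext_iff.trans (Submodule.Quotient.mk_eq_zero _)

theorem quasiCocyclesToKerComparison_surjective :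
    Function.Surjective (quasiCocyclesToKerComparison ρ) := by
  rintro ⟨z, hz⟩
  obtain ⟨⟨z, -, hz_bdd⟩, rfl⟩ := Submodule.mkQ_surjective _ z
  obtain ⟨F, rfl⟩ := (Submodule.Quotient.mk_eq_zero _).1 (LinearMap.mem_ker.1 hz)
  exact ⟨⟨F, (comap_coboundary₁_boundedFunctions ρ).le hz_bdd⟩, rfl⟩

/-- The identification of the essential quasi-cocycles with the kernel of the comparison map
induced by the coboundary. -/
noncomputable def essentialQuasiCocyclesEquivKerComparison :
    EssentialQuasiCocycles ρ ≃ₗ[𝕜] LinearMap.ker (comparison ρ) :=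
  Submodule.quotEquivOfEq _ _ (ker_quasiCocyclesToKerComparison ρ).symm ≪≫ₗ
    (quasiCocyclesToKerComparison ρ).quotKerEquivOfSurjective
      (quasiCocyclesToKerComparison_surjective ρ)

variable {ρ} in
theorem not_finiteDimensional_essentialQuasiCocycles_of_linearMap
    {V : Type*} [AddCommGroup V] [Module 𝕜 V] (hV : ¬ FiniteDimensional 𝕜 V) (Φ : V →ₗ[𝕜] G → E)
    (hΦ : ∀ v, Φ v ∈ quasiCocycles ρ)
    (hΦ_zero : ∀ v, Φ v ∈ boundedFunctions 𝕜 G E ⊔ cocycles ρ → v = 0) :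
    ¬ FiniteDimensional 𝕜 (EssentialQuasiCocycles ρ) := fun _ =>
  hV <| Module.Finite.of_injective (Submodule.mkQ _ ∘ₗ Φ.codRestrict _ hΦ) <|
    (injective_iff_map_eq_zero _).2 fun v hv =>
      hΦ_zero v <| (Submodule.Quotient.mk_eq_zero
        ((boundedFunctions 𝕜 G E ⊔ cocycles ρ).submoduleOf (quasiCocycles ρ))).1 hv

variable {ρ} in
theorem not_finiteDimensional_essentialQuasiCocycles_comp {H : Type*} [Group H]
    (h : ¬ FiniteDimensional 𝕜 (EssentialQuasiCocycles ρ)) (φ : H ≃* G) :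
    ¬ FiniteDimensional 𝕜 (EssentialQuasiCocycles (ρ.comp φ.toMonoidHom)) := fun _ => by
  have hquasi (F) (hF : F ∈ quasiCocycles ρ) :
      LinearMap.funLeft 𝕜 E φ F ∈ quasiCocycles (ρ.comp φ.toMonoidHom) :=
    comp_mem_quasiCocycles hF φ.toMonoidHom
  let Ψ : EssentialQuasiCocycles ρ →ₗ[𝕜] EssentialQuasiCocycles (ρ.comp φ.toMonoidHom) :=
    Submodule.mapQ _ _ ((LinearMap.funLeft 𝕜 E φ).restrict hquasi)
      fun F hF => comp_mem_boundedFunctions_sup_cocycles hF φ.toMonoidHom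
  refine h (Module.Finite.of_injective Ψ <| (injective_iff_map_eq_zero _).2 fun x hx => ?_)
  obtain ⟨F, rfl⟩ := Submodule.mkQ_surjective _ x
  have hF : (F.1 ∘ φ) ∘ φ.symm ∈ _ := comp_mem_boundedFunctions_sup_cocycles
    ((Submodule.Quotient.mk_eq_zero _).1 hx) φ.symm.toMonoidHom
  have hρ : (ρ.comp φ.toMonoidHom).comp φ.symm.toMonoidHom = ρ := by ext; simp
  have hcomp : (F.1 ∘ φ) ∘ φ.symm = F := funext fun g => by simp
  rw [hcomp, hρ] at hF
  exact (Submodule.Quotient.mk_eq_zero _).2 hF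

end Comparison

section ApproximateRigidity

variable {𝕜 : Type*} [RCLike 𝕜] {G : Type*} [Group G]
  {E : Type*} [NormedAddCommGroup E] [NormedSpace 𝕜 E] {ρ : G →* (E ≃ₗᵢ[𝕜] E)}

/-- If `F = B + C` with `B` bounded, each `g ∈ P` acts on the bounded set `B '' S` by the isometry
`v ↦ B g + ρ g v`. A point `c` almost fixed by all of these makes the cocycle
`g ↦ C g + (c - ρ g c)` close to `F` on `P`. -/
theorem exists_cocycle_forall_norm_sub_lt [UniformConvexSpace E] {F : G → E}
    (hF : F ∈ boundedFunctions 𝕜 G E ⊔ cocycles ρ) {P S : Set G} (hS : S.Nonempty)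
    (hPS : ∀ g ∈ P, ∀ s ∈ S, g * s ∈ S ∧ coboundary₁ ρ F (g, s) = 0) {ε : ℝ} (hε : 0 < ε) :
    ∃ C ∈ cocycles ρ, ∀ g ∈ P, ‖F g - C g‖ < ε := by
  let _ : NormedSpace ℝ E := NormedSpace.restrictScalars ℝ 𝕜 E
  obtain ⟨B, ⟨K, hK⟩, C, hC, rfl⟩ := Submodule.mem_sup.1 hF
  obtain ⟨c, hc⟩ := exists_forall_isometryEquiv_dist_lt (hS.image B)
    (isBounded_iff_forall_norm_le.2 ⟨K, Set.forall_mem_image.2 fun s _ => hK s⟩) hε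
  refine ⟨_, add_mem hC (sub_apply_mem_cocycles ρ c), fun g hg => ?_⟩
  have hmapsTo : Set.MapsTo (fun v => B g + ρ g v) (B '' S) (B '' S) := by
    rintro _ ⟨s, hs, rfl⟩
    obtain ⟨hgs, hcob⟩ := hPS g hg s hs
    rw [map_add, LinearMap.mem_ker.1 ((ker_coboundary₁ ρ).ge hC), add_zero,
      coboundary₁_eq_zero_iff] at hcob
    exact ⟨g * s, hgs, hcob⟩
  have hfix := hc ((ρ g).toIsometryEquiv.trans (IsometryEquiv.addLeft (B g))) hmapsTo
  have hsub : (B + C) g - (C + fun g => c - ρ g c) g = B g + ρ g c - c := by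
    simp only [Pi.add_apply]
    abel
  rwa [hsub, ← dist_eq_norm]

theorem eq_zero_of_forall_exists_cocycle [Infinite G] {f : G →₀ E} (hf : f 1 = 0)
    (happrox : ∀ ε > 0, ∃ C ∈ cocycles ρ, ∃ v : E, ∀ g ≠ 1, ‖f g - (C g + ρ g v)‖ < ε) :
    f = 0 := by
  ext g
  by_contra hg
  obtain ⟨C, hC, v, hv⟩ := happrox (‖f g‖ / 4) (by positivity)
  have hmul (a b : G) (hb : b ≠ 1) (hab : a * b ≠ 1) :
      ‖f (a * b) - (C a + ρ a (f b))‖ < ‖f g‖ / 4 + ‖f g‖ / 4 := by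
    have hsplit : f (a * b) - (C a + ρ a (f b)) =
        f (a * b) - (C (a * b) + ρ (a * b) v) - ρ a (f b - (C b + ρ b v)) := by
      simp only [hC a b, map_mul, map_sub, map_add, LinearIsometryEquiv.coe_mul,
        Function.comp_apply]
      abel
    rw [hsplit]
    refine (norm_sub_le _ _).trans_lt (add_lt_add (hv _ hab) ?_)
    rw [LinearIsometryEquiv.norm_map]
    exact hv b hb
  have hev : ∀ᶠ a in cofinite, a ≠ 1 ∧ f a = 0 :=
    (eventually_cofinite_ne 1).and f.hasFiniteSupport
  have hC_small (a : G) : ‖C a‖ < ‖f g‖ / 2 := by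
    obtain ⟨b, ⟨hb, hfb⟩, hab, hfab⟩ :=
      (hev.and ((mul_right_injective a).tendsto_cofinite.eventually hev)).exists
    have := hmul a b hb hab
    rw [hfb, hfab, map_zero, add_zero, zero_sub, norm_neg] at this
    linarith
  obtain ⟨a, hag, hfag⟩ := ((mul_left_injective g).tendsto_cofinite.eventually hev).exists
  have hg1 : g ≠ 1 := fun h => hg (by rw [h, hf]; rfl)
  have := hmul a g hg1 hag
  rw [hfag, zero_sub, norm_neg] at this
  have hle := norm_le_add_norm_add (ρ a (f g)) (C a)
  rw [LinearIsometryEquiv.norm_map, add_comm _ (C a)] at hle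
  linarith [hC_small a]

end ApproximateRigidity

section AlternatingFunctions

variable {𝕜 : Type*} [RCLike 𝕜] {G : Type*} [Group G]
  {E : Type*} [NormedAddCommGroup E] [NormedSpace 𝕜 E]

/-- The functions `f` with `f s⁻¹ = -ρ s⁻¹ (f s)`, the twisted analogue of odd functions; every
cocycle is one. They are the building blocks of the quasi-cocycles on a free product. -/
def alternatingFunctions (ρ : G →* (E ≃ₗᵢ[𝕜] E)) : Submodule 𝕜 (G → E) where
  carrier := {f | ∀ s, f s⁻¹ = -ρ s⁻¹ (f s)}
  zero_mem' := fun s => by simp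
  add_mem' := by
    intro f f' h h' s
    simp only [Pi.add_apply, h s, h' s, map_add, neg_add]
  smul_mem' := by
    intro c f h s
    simp only [Pi.smul_apply, h s, map_smul, smul_neg]

/-- The finitely supported alternating functions. They are the parameter space of an infinite
dimensional family of essential quasi-cocycles. -/
noncomputable def finsuppAlternatingFunctions (ρ : G →* (E ≃ₗᵢ[𝕜] E)) : Submodule 𝕜 (G →₀ E) :=
  (alternatingFunctions ρ).comap Finsupp.lcoeFun

variable {ρ : G →* (E ≃ₗᵢ[𝕜] E)}

theorem apply_apply_inv (ρ : G →* (E ≃ₗᵢ[𝕜] E)) (g : G) (e : E) : ρ g (ρ g⁻¹ e) = e := by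
  rw [map_inv, LinearIsometryEquiv.coe_inv, LinearIsometryEquiv.apply_symm_apply]

theorem apply_one_of_mem_alternatingFunctions {f : G → E} (hf : f ∈ alternatingFunctions ρ) :
    f 1 = 0 := by
  have hneg : f 1 = -f 1 := by simpa using hf 1
  rwa [eq_neg_iff_add_eq_zero, ← two_smul 𝕜, smul_eq_zero_iff_right two_ne_zero] at hneg

theorem coboundary₁_apply_inv_right {f : G → E} (hf : f ∈ alternatingFunctions ρ) (s : G) :
    coboundary₁ ρ f (s, s⁻¹) = 0 := by
  rw [coboundary₁_eq_zero_iff, mul_inv_cancel, apply_one_of_mem_alternatingFunctions hf, hf s,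
    map_neg, apply_apply_inv, add_neg_cancel]

theorem single_sub_single_inv_mem (ρ : G →* (E ≃ₗᵢ[𝕜] E)) (s : G) (e : E) :
    Finsupp.single s e - Finsupp.single s⁻¹ (ρ s⁻¹ e) ∈ finsuppAlternatingFunctions ρ := fun t => by
  have hsingle (s : G) (e : E) :
      Finsupp.single s⁻¹ (ρ s⁻¹ e) t⁻¹ = ρ t⁻¹ (Finsupp.single s e t) := by
    obtain rfl | hst := eq_or_ne t s
    · rw [Finsupp.single_eq_same, Finsupp.single_eq_same]
    · rw [Finsupp.single_eq_of_ne hst, Finsupp.single_eq_of_ne (inv_injective.ne hst), map_zero]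
  have hsingle_inv := hsingle s⁻¹ (ρ s⁻¹ e)
  rw [inv_inv, apply_apply_inv] at hsingle_inv
  rw [Finsupp.lcoeFun_apply, Finsupp.sub_apply, Finsupp.sub_apply, map_sub, ← hsingle,
    ← hsingle_inv, neg_sub]

theorem finsupp_mem_boundedFunctions {X : Type*} (f : X →₀ E) : ⇑f ∈ boundedFunctions 𝕜 X E := by
  obtain ⟨C, hC⟩ := (f.finite_range.image norm).bddAbove
  exact ⟨C, fun x => hC ⟨f x, ⟨x, rfl⟩, rfl⟩⟩

theorem exists_le_supported_of_fg {X : Type*} {W : Submodule 𝕜 (X →₀ E)} (hW : W.FG) :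
    ∃ A : Finset X, W ≤ Finsupp.supported E 𝕜 (A : Set X) := by
  classical
  obtain ⟨S, rfl⟩ := hW
  exact ⟨S.biUnion Finsupp.support, Submodule.span_le.2 fun f hf =>
    Finset.coe_subset.2 (Finset.subset_biUnion_of_mem Finsupp.support hf)⟩

theorem not_finiteDimensional_finsuppAlternatingFunctions [Nontrivial E]
    (hG : {s : G | s⁻¹ ≠ s}.Infinite) (ρ : G →* (E ≃ₗᵢ[𝕜] E)) :
    ¬ FiniteDimensional 𝕜 (finsuppAlternatingFunctions ρ) := fun h => by
  obtain ⟨A, hA⟩ := exists_le_supported_of_fg (Submodule.fg_iff_finiteDimensional _ |>.2 h)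
  obtain ⟨s, hs, hsA⟩ := hG.exists_notMem_finset A
  obtain ⟨e, he⟩ := exists_ne (0 : E)
  have hzero := (Finsupp.mem_supported' 𝕜 _).1 (hA (single_sub_single_inv_mem ρ s e)) s hsA
  rw [Finsupp.sub_apply, Finsupp.single_eq_same, Finsupp.single_eq_of_ne hs.symm,
    sub_zero] at hzero
  exact he hzero

end AlternatingFunctions

section SyllableCochain

variable {𝕜 : Type*} [RCLike 𝕜] {ι : Type*} {G : ι → Type*} [∀ i, Group (G i)]
  {E : Type*} [NormedAddCommGroup E] [NormedSpace 𝕜 E] [DecidableEq ι] [∀ i, DecidableEq (G i)]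

/-- The index of the factor containing the first syllable of the normal form of an element of a
free product, `none` for the identity. -/
abbrev firstFactor (g : Monoid.CoprodI G) : Option ι := (Word.equiv g).fstIdx

theorem firstFactor_one : firstFactor (1 : Monoid.CoprodI G) = none :=
  congrArg Word.fstIdx (one_smul (Monoid.CoprodI G) Word.empty)

theorem wordEquiv_of_mul {i : ι} {s : G i} (hs : s ≠ 1) {g : Monoid.CoprodI G}
    (hg : firstFactor g ≠ some i) : Word.equiv (of s * g) = Word.cons s (Word.equiv g) hg hs := by
  rw [Word.cons_eq_smul]
  exact mul_smul (of s) g (Word.empty : Word G)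

theorem firstFactor_of_mul {i : ι} {s : G i} (hs : s ≠ 1) {g : Monoid.CoprodI G}
    (hg : firstFactor g ≠ some i) : firstFactor (of s * g) = some i := by
  rw [firstFactor, wordEquiv_of_mul hs hg, Word.fstIdx_cons]

theorem firstFactor_of {i : ι} {s : G i} (hs : s ≠ 1) :
    firstFactor (of s : Monoid.CoprodI G) = some i := by
  simpa using firstFactor_of_mul hs (g := 1) (by simp [firstFactor_one])

theorem exists_eq_of_mul (i : ι) (g : Monoid.CoprodI G) :
    ∃ (t : G i) (k : Monoid.CoprodI G), firstFactor k ≠ some i ∧ g = of t * k := by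
  set p := Word.equivPair i (Word.equiv g)
  refine ⟨p.head, Word.equiv.symm p.tail, ?_, ?_⟩
  · rw [firstFactor, Equiv.apply_symm_apply]
    exact p.fstIdx_ne
  · rw [← Word.equiv.symm_apply_apply g, ← (Word.equivPair i).symm_apply_apply (Word.equiv g)]
    exact Word.prod_rcons p

@[elab_as_elim]
theorem syllable_induction {motive : Monoid.CoprodI G → Prop} (one : motive 1)
    (of_mul : ∀ i (s : G i) g, s ≠ 1 → firstFactor g ≠ some i → motive g → motive (of s * g))
    (g : Monoid.CoprodI G) : motive g := by
  obtain ⟨w, rfl⟩ := Word.equiv.symm.surjective g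
  induction w using Word.consRecOn with
  | empty => exact one
  | cons i s w hw hs ih =>
    have hprod : Word.equiv.symm (Word.cons s w hw hs) = of s * Word.equiv.symm w :=
      Word.prod_cons i s w hs hw
    rw [hprod]
    exact of_mul i s _ hs (by rwa [firstFactor, Equiv.apply_symm_apply]) ih

/-- Rolli's construction: the function on a free product whose value at an element with normal form
`s₁ ⋯ sₙ` is `∑ k, ρ (s₁ ⋯ sₖ₋₁) (lam sₖ)`. -/
def syllableCochain (ρ : Monoid.CoprodI G →* (E ≃ₗᵢ[𝕜] E)) :
    (∀ i, G i → E) →ₗ[𝕜] Monoid.CoprodI G → E where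
  toFun lam g := (Word.equiv g).toList.foldr (fun s v => lam s.1 s.2 + ρ (of s.2) v) 0
  map_add' lam lam' := by
    funext g
    simp only [Pi.add_apply]
    induction (Word.equiv g).toList with
    | nil => simp only [List.foldr_nil, add_zero]
    | cons s l ih => simp only [List.foldr_cons, ih, map_add, add_add_add_comm]
  map_smul' c lam := by
    funext g
    simp only [Pi.smul_apply, RingHom.id_apply]
    induction (Word.equiv g).toList with
    | nil => simp only [List.foldr_nil, smul_zero]
    | cons s l ih => simp only [List.foldr_cons, ih, map_smul, smul_add]

variable {ρ : Monoid.CoprodI G →* (E ≃ₗᵢ[𝕜] E)} {lam : ∀ i, G i → E}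

theorem syllableCochain_one : syllableCochain ρ lam 1 = 0 :=
  congrArg (fun w : Word G => w.toList.foldr (fun s v => lam s.1 s.2 + ρ (of s.2) v) 0)
    (one_smul (Monoid.CoprodI G) Word.empty)

theorem syllableCochain_of_mul {i : ι} (hlam : lam i 1 = 0) (s : G i) {g : Monoid.CoprodI G}
    (hg : firstFactor g ≠ some i) :
    syllableCochain ρ lam (of s * g) = lam i s + ρ (of s) (syllableCochain ρ lam g) := by
  by_cases hs : s = 1
  · simp [hs, hlam]
  · simp only [syllableCochain, LinearMap.coe_mk, AddHom.coe_mk, wordEquiv_of_mul hs hg,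
      Word.cons_toList, List.foldr_cons]

theorem syllableCochain_of {i : ι} (hlam : lam i 1 = 0) (s : G i) :
    syllableCochain ρ lam (of s) = lam i s := by
  have h1 : firstFactor (1 : Monoid.CoprodI G) ≠ some i := by simp [firstFactor_one]
  simpa [syllableCochain_one] using syllableCochain_of_mul (ρ := ρ) hlam s h1

theorem coboundary₁_syllableCochain_of {i : ι} (hlam : lam i 1 = 0) (s : G i)
    {g : Monoid.CoprodI G} (hg : firstFactor g ≠ some i) :
    coboundary₁ ρ (syllableCochain ρ lam) (of s, g) = 0 := by
  rw [coboundary₁_eq_zero_iff, syllableCochain_of_mul hlam s hg, syllableCochain_of hlam]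

theorem coboundary₁_syllableCochain_of_of_mul {i : ι} (hlam : lam i 1 = 0) (s t : G i)
    {g : Monoid.CoprodI G} (hg : firstFactor g ≠ some i) :
    coboundary₁ ρ (syllableCochain ρ lam) (of s, of t * g) =
      coboundary₁ (ρ.comp of) (lam i) (s, t) := by
  rw [coboundary₁_apply, coboundary₁_apply, ← mul_assoc, ← map_mul,
    syllableCochain_of_mul hlam t hg, syllableCochain_of_mul hlam (s * t) hg,
    syllableCochain_of hlam]
  simp only [map_add, map_mul, LinearIsometryEquiv.coe_mul, Function.comp_apply,
    MonoidHom.comp_apply]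
  abel

/-- When two normal forms are multiplied, syllables cancel until at most one pair merges into a
nontrivial syllable, and only that pair contributes to the coboundary. -/
theorem coboundary₁_syllableCochain_eq_zero_or
    (hlam : ∀ i, lam i ∈ alternatingFunctions (ρ.comp of)) {K : ℝ}
    (hK : ∀ i p, ‖coboundary₁ (ρ.comp of) (lam i) p‖ ≤ K) (g h : Monoid.CoprodI G) :
    coboundary₁ ρ (syllableCochain ρ lam) (g, h) = 0 ∨
      firstFactor (g * h) = firstFactor g ∧
        ‖coboundary₁ ρ (syllableCochain ρ lam) (g, h)‖ ≤ K := by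
  have hlam_one i := apply_one_of_mem_alternatingFunctions (hlam i)
  induction g using syllable_induction with
  | one => simp [coboundary₁_apply, syllableCochain_one]
  | of_mul i s g hs hg ih =>
    rw [firstFactor_of_mul hs hg, coboundary₁_mul_left,
      coboundary₁_syllableCochain_of (hlam_one i) s hg, sub_zero, mul_assoc]
    rcases ih with hzero | ⟨hfirst, hbound⟩
    · obtain ⟨t, k, hk, hgh⟩ := exists_eq_of_mul i (g * h)
      rw [hzero, map_zero, zero_add, hgh,
        coboundary₁_syllableCochain_of_of_mul (hlam_one i) s t hk]
      by_cases hst : s * t = 1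
      · left
        rw [← inv_eq_of_mul_eq_one_right hst, coboundary₁_apply_inv_right (hlam i)]
      · right
        rw [← mul_assoc, ← map_mul]
        exact ⟨firstFactor_of_mul hst hk, hK i _⟩
    · right
      rw [← hfirst] at hg
      rw [coboundary₁_syllableCochain_of (hlam_one i) s hg, add_zero,
        LinearIsometryEquiv.norm_map]
      exact ⟨firstFactor_of_mul hs hg, hbound⟩

theorem syllableCochain_mem_quasiCocycles
    (hlam : ∀ i, lam i ∈ alternatingFunctions (ρ.comp of)) {K : ℝ}
    (hK : ∀ i p, ‖coboundary₁ (ρ.comp of) (lam i) p‖ ≤ K) :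
    syllableCochain ρ lam ∈ quasiCocycles ρ := by
  rw [← comap_coboundary₁_boundedFunctions]
  refine ⟨|K|, fun p => ?_⟩
  rcases coboundary₁_syllableCochain_eq_zero_or hlam hK p.1 p.2 with hzero | ⟨-, hbound⟩
  · rw [hzero, norm_zero]
    exact abs_nonneg K
  · exact hbound.trans (le_abs_self K)

end SyllableCochain

section FreeProduct

variable {𝕜 : Type*} [RCLike 𝕜] {ι : Type*} {G : ι → Type*} [∀ i, Group (G i)]
  {E : Type*} [NormedAddCommGroup E] [NormedSpace 𝕜 E] [DecidableEq ι] [∀ i, DecidableEq (G i)]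
  {ρ : Monoid.CoprodI G →* (E ≃ₗᵢ[𝕜] E)} {i : ι}

theorem syllableCochain_single_mem_quasiCocycles {f : G i → E}
    (hf : f ∈ alternatingFunctions (ρ.comp of)) (hb : f ∈ boundedFunctions 𝕜 (G i) E) :
    syllableCochain ρ (Pi.single i f) ∈ quasiCocycles ρ := by
  obtain ⟨K, hK⟩ := coboundary₁_bounded (ρ.comp of) hb
  refine syllableCochain_mem_quasiCocycles (K := K) (fun j => ?_) fun j p => ?_
  · obtain rfl | hj := eq_or_ne j i
    · rwa [Pi.single_eq_same]
    · rw [Pi.single_eq_of_ne hj]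
      exact zero_mem _
  · obtain rfl | hj := eq_or_ne j i
    · rw [Pi.single_eq_same]
      exact hK p
    · rw [Pi.single_eq_of_ne hj, map_zero, Pi.zero_apply, norm_zero]
      exact (norm_nonneg _).trans (hK 1)

theorem coboundary₁_syllableCochain_of_mul_of {lam : ∀ i, G i → E} {j : ι} (hij : i ≠ j)
    (hi : lam i 1 = 0) (hj : lam j 1 = 0) (a : G i) {b : G j} (hb : b ≠ 1)
    {g : Monoid.CoprodI G} (hg : firstFactor g ≠ some j) :
    coboundary₁ ρ (syllableCochain ρ lam) (of a * of b, g) = 0 := by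
  have hji : some j ≠ some i := fun h => hij (Option.some.inj h).symm
  rw [coboundary₁_mul_left, coboundary₁_syllableCochain_of hj b hg,
    coboundary₁_syllableCochain_of hi a (by rwa [firstFactor_of_mul hb hg]),
    coboundary₁_syllableCochain_of hi a (by rwa [firstFactor_of hb]), map_zero, add_zero, sub_zero]

theorem eq_zero_of_syllableCochain_single_mem [UniformConvexSpace E] {j : ι} (hij : i ≠ j)
    [Infinite (G i)] [Nontrivial (G j)] {f : G i →₀ E} (hf : f 1 = 0)
    (hF : syllableCochain ρ (Pi.single i f) ∈ boundedFunctions 𝕜 _ E ⊔ cocycles ρ) : f = 0 := by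
  obtain ⟨b, hb⟩ := exists_ne (1 : G j)
  have hi : (Pi.single i f : ∀ k, G k → E) i = f := Pi.single_eq_same i _
  have hj : (Pi.single i f : ∀ k, G k → E) j = 0 := Pi.single_eq_of_ne hij.symm _
  have hi_one := (congrFun hi 1).trans hf
  have hj_one := congrFun hj 1
  have hji : some j ≠ some i := fun h => hij (Option.some.inj h).symm
  have hvalue (a : G i) : syllableCochain ρ (Pi.single i f) (of a * of b) = f a := by
    rw [syllableCochain_of_mul hi_one a (by rwa [firstFactor_of hb]),
      syllableCochain_of hj_one, hi, hj, Pi.zero_apply, map_zero, add_zero]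
  refine eq_zero_of_forall_exists_cocycle (ρ := ρ.comp of) hf fun ε hε => ?_
  obtain ⟨C, hC, hclose⟩ := exists_cocycle_forall_norm_sub_lt hF
    (P := (fun a : G i => of a * of b) '' {1}ᶜ) (S := {g | firstFactor g ≠ some j})
    ⟨1, by simp [firstFactor_one]⟩
    (by
      rintro _ ⟨a, ha, rfl⟩ g hg
      refine ⟨?_, coboundary₁_syllableCochain_of_mul_of hij hi_one hj_one a hb hg⟩
      rw [Set.mem_ofPred_eq, mul_assoc,
        firstFactor_of_mul ha (by rwa [firstFactor_of_mul hb hg])]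
      exact hji.symm) hε
  refine ⟨C ∘ of, fun a a' => by simpa using hC (of a) (of a'), C (of b), fun a ha => ?_⟩
  have hbound := hclose _ ⟨a, ha, rfl⟩
  rwa [hvalue, hC] at hbound

end FreeProduct

theorem not_finiteDimensional_essentialQuasiCocycles_coprodI {𝕜 : Type*} [RCLike 𝕜]
    {E : Type*} [NormedAddCommGroup E] [NormedSpace 𝕜 E] [UniformConvexSpace E] [Nontrivial E]
    {ι : Type*} {G : ι → Type*} [∀ i, Group (G i)] {i j : ι} (hij : i ≠ j)
    (hi : {s : G i | s⁻¹ ≠ s}.Infinite) [Nontrivial (G j)] (ρ : Monoid.CoprodI G →* (E ≃ₗᵢ[𝕜] E)) :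
    ¬ FiniteDimensional 𝕜 (EssentialQuasiCocycles ρ) := by
  classical
  have : Infinite (G i) := Set.infinite_univ_iff.1 (hi.mono (Set.subset_univ _))
  exact not_finiteDimensional_essentialQuasiCocycles_of_linearMap
    (not_finiteDimensional_finsuppAlternatingFunctions hi (ρ.comp of))
    (syllableCochain ρ ∘ₗ LinearMap.single 𝕜 (fun k => G k → E) i ∘ₗ Finsupp.lcoeFun ∘ₗ
      (finsuppAlternatingFunctions (ρ.comp of)).subtype)
    (fun f => syllableCochain_single_mem_quasiCocycles f.2 (finsupp_mem_boundedFunctions f.1))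
    fun f hf => Subtype.ext <| eq_zero_of_syllableCochain_single_mem hij
      (apply_one_of_mem_alternatingFunctions f.2) hf

end QuasiCocycle

open QuasiCocycle in
theorem theorem3_general {𝕜 : Type*} [RCLike 𝕜] {E : Type*} [NormedAddCommGroup E]
    [NormedSpace 𝕜 E] [UniformConvexSpace E] [Nontrivial E] {Γ : Type*} [Group Γ]
    {ι : Type*} {G : ι → Type*} [∀ i, Group (G i)] (φ : Γ ≃* Monoid.CoprodI G) {i j : ι}
    (hij : i ≠ j) (hi : {s : G i | s⁻¹ ≠ s}.Infinite) [Nontrivial (G j)]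
    (ρ : Γ →* (E ≃ₗᵢ[𝕜] E)) :
    ¬ FiniteDimensional 𝕜 (EssentialQuasiCocycles ρ) ∧
    ¬ FiniteDimensional 𝕜 (LinearMap.ker (comparison ρ)) := by
  have hessential : ¬ FiniteDimensional 𝕜 (EssentialQuasiCocycles ρ) := by
    have hρ : (ρ.comp φ.symm.toMonoidHom).comp φ.toMonoidHom = ρ := by ext; simp
    rw [← hρ]
    exact not_finiteDimensional_essentialQuasiCocycles_comp
      (not_finiteDimensional_essentialQuasiCocycles_coprodI hij hi _) φ
  exact ⟨hessential, fun _ => hessential <|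
    Module.Finite.equiv (essentialQuasiCocyclesEquivKerComparison ρ).symm⟩

theorem infinite_setOf_inv_ne_self {G : Type*} [Group G] [IsMulTorsionFree G] [Infinite G] :
    {s : G | s⁻¹ ≠ s}.Infinite := by
  simp only [inv_ne_self]
  exact (Set.finite_singleton 1).infinite_compl

theorem theorem3 {𝕜 : Type*} [RCLike 𝕜] {E : Type*} [NormedAddCommGroup E] [NormedSpace 𝕜 E]
    [CompleteSpace E] [UniformConvexSpace E] [Nontrivial E]
    (ρ : FreeGroup (Fin 2) →* (E ≃ₗᵢ[𝕜] E)) :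
    ¬ FiniteDimensional 𝕜 (QuasiCocycle.EssentialQuasiCocycles ρ) ∧
    ¬ FiniteDimensional 𝕜 (LinearMap.ker (QuasiCocycle.comparison ρ)) := by
  exact theorem3_general freeGroupEquivCoprodI (zero_ne_one (α := Fin 2))
    infinite_setOf_inv_ne_self ρ
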